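/- For $n\ge 0$ let $\mathcal P_n=\{\pm1,\pm i\}\times\{I,X,Y,Z\}^{\otimes n}$ be the $n$-qubit Pauli group, whose elements are called Paulis. A unitary $V\in U(2^n)$ is called a Clifford if $VPV^\dagger\in\mathcal P_n$ for every $P\in\mathcal P_n$. A Pauli-square-root Clifford (PSC) is a Clifford $U\notin\mathcal P_n$ such that $U^2\in\mathcal P_n$. Let $U\in U(2^n)$ be a unitary. Then $U$ is a Clifford with $U^2\in\mathcal P_n$ if and only if it can be written in the form $$U=\alpha\,P\,\exp\Bigl(\frac{\pi i}{4}\sum_{j=1}^m Q_j\Bigr),\qquad(\ast)$$ where $m\ge 0$, $P\in\mathcal P_n$, $Q_1,\dots,Q_m\in\mathcal P_n$ are Hermitian and pairwise commuting, and $\alpha\in\mathbb C$ satisfies $\alpha^8=1$. Consequently, $U$ is a PSC if and only if $U\notin\mathcal P_n$ and $U$ can be written in the form $(\ast)$. -/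

import Mathlib

/-- Square complex matrices on `n` qubits; the computational basis is indexed by bit strings. -/
abbrev QubitMatrix (n : ℕ) : Type := Matrix (Fin n → Fin 2) (Fin n → Fin 2) ℂ

/-- The single-qubit Pauli matrices `I, X, Y, Z`, labelled by `0, 1, 2, 3`. -/
noncomputable def pauliMatrix : Fin 4 → Matrix (Fin 2) (Fin 2) ℂ :=
  ![!![1, 0; 0, 1], !![0, 1; 1, 0], !![0, -Complex.I; Complex.I, 0], !![1, 0; 0, -1]]

/-- The tensor product over the `n` qubits of the single-qubit Pauli matrices with labels `s`. -/
noncomputable def pauliString {n : ℕ} (s : Fin n → Fin 4) : QubitMatrix n :=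
  Matrix.of fun x y => ∏ k, pauliMatrix (s k) (x k) (y k)

/-- Membership in the `n`-qubit Pauli group `{1, -1, i, -i} × {I, X, Y, Z}^{⊗ n}`. -/
def IsPauli {n : ℕ} (M : QubitMatrix n) : Prop :=
  ∃ (c : ℂ) (s : Fin n → Fin 4), c ^ 4 = 1 ∧ M = c • pauliString s

/-- Membership in the `n`-qubit Clifford group: the unitaries (with arbitrary global phase)
that conjugate every element of the Pauli group into the Pauli group. -/
def IsClifford {n : ℕ} (U : Matrix.unitaryGroup (Fin n → Fin 2) ℂ) : Prop :=
  ∀ P : QubitMatrix n, IsPauli P →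
    IsPauli ((U : QubitMatrix n) * P * (U : QubitMatrix n).conjTranspose)

/-- `U` is a Clifford whose square is a Pauli (`U` itself may be a Pauli). -/
def IsCliffordWithPauliSquare {n : ℕ} (U : Matrix.unitaryGroup (Fin n → Fin 2) ℂ) : Prop :=
  IsClifford U ∧ IsPauli ((U : QubitMatrix n) ^ 2)

/-- `U` is a Pauli-square-root Clifford: a non-Pauli Clifford whose square is a Pauli. -/
def IsPSC {n : ℕ} (U : Matrix.unitaryGroup (Fin n → Fin 2) ℂ) : Prop :=
  IsCliffordWithPauliSquare U ∧ ¬ IsPauli (U : QubitMatrix n)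

/-- `M = α P exp ((π i / 4) ∑ j, Q j)` with `α ^ 8 = 1`, `P` a Pauli and `Q 1, …, Q m` pairwise
commuting Hermitian Paulis (that is, Pauli strings with a sign `1` or `-1`), `m ≥ 0`. -/
def HasPSCForm {n : ℕ} (M : QubitMatrix n) : Prop :=
  ∃ (α : ℂ) (P : QubitMatrix n) (m : ℕ) (Q : Fin m → QubitMatrix n),
    α ^ 8 = 1 ∧ IsPauli P ∧
    (∀ j, IsPauli (Q j) ∧ (Q j).IsHermitian) ∧
    (∀ j k, Commute (Q j) (Q k)) ∧
    M = α • (P * NormedSpace.exp (((Real.pi : ℂ) * Complex.I / 4) • ∑ j, Q j))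

/-! For a Hermitian Pauli Q put T_Q = exp(πiQ/4) = (1 + iQ)/√2. Conjugation by T_Q fixes the Paulis
commuting with Q and sends an anticommuting A to iQA, and T_Q² = iQ. Hence T_Q A T_Q is always a
Pauli, which gives the direction from (∗) to Cliffords (`exp_sum_properties`).

For the other direction, rotations are peeled off. If U x U⁻¹ = B, let Q be the Hermitian Pauli
proportional to Bx. As U² is a Pauli, U exchanges x and B up to sign, so U and Q commute up to sign
and V = U T_{-Q} again has Pauli square. Also Q commutes with every Pauli that U fixes up to a
scalar, so V fixes those too; if x and B anticommute, V fixes x as well. If every Pauli commutes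
with its image, one preliminary rotation creates an anticommuting pair (`exists_reduction`). The
number of moved strings thus drops until a scalar times a Pauli remains (`exists_isPauli_eq_smul`).
The rotations commute because each Q is fixed at all later stages. -/

/-! ### Algebra of Pauli strings. -/

theorem pauliString_mul_apply {n : ℕ} (s t : Fin n → Fin 4) (x y : Fin n → Fin 2) :
    (pauliString s * pauliString t) x y =
      ∏ k, (pauliMatrix (s k) * pauliMatrix (t k)) (x k) (y k) := by
  simp only [Matrix.mul_apply, pauliString, Matrix.of_apply, ← Finset.prod_mul_distrib]
  rw [Finset.prod_univ_sum, Fintype.piFinset_univ]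

theorem pauliMatrix_mul (a b : Fin 4) :
    ∃ (c : ℂ) (d : Fin 4), c ^ 4 = 1 ∧ pauliMatrix a * pauliMatrix b = c • pauliMatrix d := by
  have h1 : (1 : ℂ) ^ 4 = 1 := by norm_num
  have h2 : Complex.I ^ 4 = 1 := Complex.I_pow_four
  have h3 : (-Complex.I) ^ 4 = 1 := by rw [Even.neg_pow (by decide)]; exact h2
  fin_cases a <;> fin_cases b
  · exact ⟨1, 0, h1, by ext i j; fin_cases i <;> fin_cases j <;> simp [pauliMatrix]⟩
  · exact ⟨1, 1, h1, by ext i j; fin_cases i <;> fin_cases j <;> simp [pauliMatrix]⟩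
  · exact ⟨1, 2, h1, by ext i j; fin_cases i <;> fin_cases j <;> simp [pauliMatrix]⟩
  · exact ⟨1, 3, h1, by ext i j; fin_cases i <;> fin_cases j <;> simp [pauliMatrix]⟩
  · exact ⟨1, 1, h1, by ext i j; fin_cases i <;> fin_cases j <;> simp [pauliMatrix]⟩
  · exact ⟨1, 0, h1, by ext i j; fin_cases i <;> fin_cases j <;> simp [pauliMatrix]⟩
  · exact ⟨Complex.I, 3, h2, by ext i j; fin_cases i <;> fin_cases j <;> simp [pauliMatrix]⟩
  · exact ⟨-Complex.I, 2, h3, by ext i j; fin_cases i <;> fin_cases j <;> simp [pauliMatrix]⟩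
  · exact ⟨1, 2, h1, by ext i j; fin_cases i <;> fin_cases j <;> simp [pauliMatrix]⟩
  · exact ⟨-Complex.I, 3, h3, by ext i j; fin_cases i <;> fin_cases j <;> simp [pauliMatrix]⟩
  · exact ⟨1, 0, h1, by ext i j; fin_cases i <;> fin_cases j <;> simp [pauliMatrix]⟩
  · exact ⟨Complex.I, 1, h2, by ext i j; fin_cases i <;> fin_cases j <;> simp [pauliMatrix]⟩
  · exact ⟨1, 3, h1, by ext i j; fin_cases i <;> fin_cases j <;> simp [pauliMatrix]⟩
  · exact ⟨Complex.I, 2, h2, by ext i j; fin_cases i <;> fin_cases j <;> simp [pauliMatrix]⟩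
  · exact ⟨-Complex.I, 1, h3, by ext i j; fin_cases i <;> fin_cases j <;> simp [pauliMatrix]⟩
  · exact ⟨1, 0, h1, by ext i j; fin_cases i <;> fin_cases j <;> simp [pauliMatrix]⟩

theorem pauliMatrix_commute_or (a b : Fin 4) :
    ∃ e : ℂ, (e = 1 ∨ e = -1) ∧
      pauliMatrix a * pauliMatrix b = e • (pauliMatrix b * pauliMatrix a) := by
  by_cases h : pauliMatrix a * pauliMatrix b = pauliMatrix b * pauliMatrix a
  · exact ⟨1, Or.inl rfl, by rw [one_smul, h]⟩
  · refine ⟨-1, Or.inr rfl, ?_⟩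
    fin_cases a <;> fin_cases b <;>
      first
        | (ext i j; fin_cases i <;> fin_cases j <;> simp [pauliMatrix]; done)
        | (exfalso; apply h; ext i j; fin_cases i <;> fin_cases j <;> simp [pauliMatrix])

theorem pauliMatrix_mul_self (a : Fin 4) : pauliMatrix a * pauliMatrix a = 1 := by
  fin_cases a <;> ext i j <;> fin_cases i <;> fin_cases j <;> simp [pauliMatrix]

theorem pauliMatrix_star_apply (a : Fin 4) (i j : Fin 2) :
    star (pauliMatrix a j i) = pauliMatrix a i j := by
  fin_cases a <;> fin_cases i <;> fin_cases j <;> simp [pauliMatrix]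

/-- |0⟩⟨0| and |1⟩⟨1| are (I ± Z)/2; |0⟩⟨1| and |1⟩⟨0| are (X ± iY)/2. -/
theorem single_eq_sum_pauliMatrix (a b : Fin 2) :
    ∃ c : Fin 4 → ℂ, ∀ i j, Matrix.single a b (1 : ℂ) i j = ∑ t, c t * pauliMatrix t i j := by
  fin_cases a <;> fin_cases b
  · refine ⟨![1/2, 0, 0, 1/2], fun i j => ?_⟩
    fin_cases i <;> fin_cases j <;> simp [pauliMatrix, Fin.sum_univ_four, Matrix.single] <;> norm_num
  · refine ⟨![0, 1/2, Complex.I/2, 0], fun i j => ?_⟩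
    fin_cases i <;> fin_cases j <;> simp [pauliMatrix, Fin.sum_univ_four, Matrix.single] <;>
      ring_nf <;> simp only [Complex.I_sq] <;> norm_num
  · refine ⟨![0, 1/2, -Complex.I/2, 0], fun i j => ?_⟩
    fin_cases i <;> fin_cases j <;> simp [pauliMatrix, Fin.sum_univ_four, Matrix.single] <;>
      ring_nf <;> simp only [Complex.I_sq] <;> norm_num
  · refine ⟨![1/2, 0, 0, -1/2], fun i j => ?_⟩
    fin_cases i <;> fin_cases j <;> simp [pauliMatrix, Fin.sum_univ_four, Matrix.single] <;> norm_num

theorem pauliString_mul {n : ℕ} (s t : Fin n → Fin 4) :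
    IsPauli (pauliString s * pauliString t) := by
  choose c d hc h using fun k => pauliMatrix_mul (s k) (t k)
  refine ⟨∏ k, c k, d, by rw [← Finset.prod_pow]; simp [hc], ?_⟩
  ext x y
  rw [pauliString_mul_apply]
  simp [h, pauliString, Finset.prod_mul_distrib]

theorem pauliString_commute_or {n : ℕ} (s t : Fin n → Fin 4) :
    ∃ e : ℂ, (e = 1 ∨ e = -1) ∧
      pauliString s * pauliString t = e • (pauliString t * pauliString s) := by
  choose e he h using fun k => pauliMatrix_commute_or (s k) (t k)
  refine ⟨∏ k, e k, ?_, ?_⟩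
  · refine Finset.prod_induction e (fun e => e = 1 ∨ e = -1) ?_ (Or.inl rfl) fun k _ => he k
    rintro a b (rfl | rfl) (rfl | rfl) <;> simp
  · ext x y
    rw [pauliString_mul_apply, Matrix.smul_apply, pauliString_mul_apply]
    simp [h, Finset.prod_mul_distrib]

theorem pauliString_mul_self {n : ℕ} (s : Fin n → Fin 4) : pauliString s * pauliString s = 1 := by
  ext x y
  rw [pauliString_mul_apply]
  simp only [pauliMatrix_mul_self, Matrix.one_apply, funext_iff]
  simp [Finset.prod_ite_zero]

theorem pauliString_isHermitian {n : ℕ} (s : Fin n → Fin 4) : (pauliString s).IsHermitian := by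
  ext x y
  simp only [Matrix.conjTranspose_apply, pauliString, Matrix.of_apply, star_prod,
    pauliMatrix_star_apply]

theorem pauliString_zero {n : ℕ} : pauliString (fun _ : Fin n => 0) = 1 := by
  have h : pauliMatrix 0 = 1 := by
    ext i j; fin_cases i <;> fin_cases j <;> simp [pauliMatrix]
  ext x y
  simp only [pauliString, h, Matrix.of_apply, Matrix.one_apply, funext_iff]
  simp [Finset.prod_ite_zero]

theorem span_pauliString (n : ℕ) :
    Submodule.span ℂ (Set.range (pauliString : (Fin n → Fin 4) → QubitMatrix n)) = ⊤ := by
  rw [eq_top_iff]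
  intro M _
  rw [Matrix.matrix_eq_sum_single M]
  refine Submodule.sum_mem _ fun x _ => Submodule.sum_mem _ fun y _ => ?_
  have hxy : Matrix.single x y (M x y) = M x y • Matrix.single x y (1 : ℂ) := by simp
  rw [hxy]
  refine Submodule.smul_mem _ _ ?_
  choose c hc using fun k => single_eq_sum_pauliMatrix (x k) (y k)
  have h : Matrix.single x y (1 : ℂ) = ∑ s : Fin n → Fin 4, (∏ k, c k (s k)) • pauliString s := by
    ext i j
    have h1 : Matrix.single x y (1 : ℂ) i j = ∏ k, Matrix.single (x k) (y k) (1 : ℂ) (i k) (j k) := by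
      simp only [Matrix.single, Matrix.of_apply, funext_iff]
      rw [Finset.prod_ite_zero]
      simp [forall_and]
    rw [h1]
    simp only [hc]
    rw [Finset.prod_univ_sum, Fintype.piFinset_univ, Matrix.sum_apply]
    simp [pauliString, Finset.prod_mul_distrib]
  rw [h]
  exact Submodule.sum_mem _ fun s _ =>
    Submodule.smul_mem _ _ (Submodule.subset_span ⟨s, rfl⟩)

/-! ### The Pauli group. -/

namespace IsPauli

variable {n : ℕ} {A B Q : QubitMatrix n}

theorem pauliString {n : ℕ} (s : Fin n → Fin 4) : IsPauli (pauliString s) :=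
  ⟨1, s, one_pow 4, (one_smul _ _).symm⟩

theorem one {n : ℕ} : IsPauli (1 : QubitMatrix n) :=
  ⟨1, fun _ => 0, one_pow 4, by rw [pauliString_zero, one_smul]⟩

theorem smul (hA : IsPauli A) {c : ℂ} (hc : c ^ 4 = 1) : IsPauli (c • A) := by
  obtain ⟨d, s, hd, rfl⟩ := hA
  exact ⟨c * d, s, by rw [mul_pow, hc, hd, one_mul], smul_smul _ _ _⟩

theorem neg (hA : IsPauli A) : IsPauli (-A) := by
  rw [← neg_one_smul ℂ]
  exact hA.smul (by norm_num)

theorem mul (hA : IsPauli A) (hB : IsPauli B) : IsPauli (A * B) := by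
  obtain ⟨c, s, hc, rfl⟩ := hA
  obtain ⟨d, t, hd, rfl⟩ := hB
  rw [smul_mul_smul_comm]
  exact (pauliString_mul s t).smul (by rw [mul_pow, hc, hd, one_mul])

theorem ne_zero_of_pow_four {c : ℂ} (hc : c ^ 4 = 1) : c ≠ 0 := by
  rintro rfl
  norm_num at hc

theorem exists_mul_self (hA : IsPauli A) : ∃ d : ℂ, d ^ 2 = 1 ∧ A * A = d • 1 := by
  obtain ⟨c, s, hc, rfl⟩ := hA
  refine ⟨c * c, by linear_combination hc, ?_⟩
  rw [smul_mul_smul_comm, pauliString_mul_self]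

/-- A phase with fourth power 1 has modulus 1, so A is unitary, and A² = A†A. -/
theorem mul_self_of_isHermitian (hA : IsPauli A) (h : A.IsHermitian) : A * A = 1 := by
  obtain ⟨c, s, hc, rfl⟩ := hA
  have hs := pauliString_isHermitian s
  have h1 : (c • _root_.pauliString s).conjTranspose * (c • _root_.pauliString s)
      = (star c * c) • (1 : QubitMatrix n) := by
    rw [Matrix.conjTranspose_smul, hs.eq, smul_mul_smul_comm, pauliString_mul_self]
  rw [h.eq] at h1
  rw [h1]
  have h2 : ‖c‖ = 1 := (pow_eq_one_iff_of_nonneg (norm_nonneg c) (by norm_num : 4 ≠ 0)).1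
    (by rw [← norm_pow, hc, norm_one])
  have h3 : star c * c = 1 := by
    have := Complex.conj_mul' c
    rw [h2] at this
    simpa using this
  rw [h3, one_smul]

theorem commute_or (hA : IsPauli A) (hB : IsPauli B) :
    ∃ e : ℂ, (e = 1 ∨ e = -1) ∧ A * B = e • (B * A) := by
  obtain ⟨c, s, hc, rfl⟩ := hA
  obtain ⟨d, t, hd, rfl⟩ := hB
  obtain ⟨e, he, h⟩ := pauliString_commute_or s t
  refine ⟨e, he, ?_⟩
  rw [smul_mul_smul_comm, smul_mul_smul_comm, h, smul_smul, smul_smul]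
  congr 1
  ring

theorem pow_four (hA : IsPauli A) : A ^ 4 = 1 := by
  obtain ⟨d, hd, h⟩ := hA.exists_mul_self
  rw [show A ^ 4 = (A * A) * (A * A) by noncomm_ring, h, smul_mul_smul_comm, ← sq, hd, one_mul,
    one_smul]

theorem isUnit (hA : IsPauli A) : IsUnit A :=
  IsUnit.of_pow_eq_one hA.pow_four (by norm_num)

theorem exists_isHermitian (hA : IsPauli A) :
    ∃ (Q : QubitMatrix n) (d : ℂ), d ≠ 0 ∧ IsPauli Q ∧ Q.IsHermitian ∧ A = d • Q := by
  obtain ⟨c, s, hc, rfl⟩ := hA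
  exact ⟨_, c, ne_zero_of_pow_four hc, .pauliString s, pauliString_isHermitian s, rfl⟩

theorem pow_four_eq_one_of_smul (hA : IsPauli A) {c : ℂ} (h : IsPauli (c • A)) : c ^ 4 = 1 := by
  have h1 := h.pow_four
  rw [smul_pow, hA.pow_four] at h1
  have h2 := congrFun (congrFun h1 0) 0
  simpa using h2

end IsPauli

/-! ### Consequences of Paulis spanning the matrix algebra. -/

theorem eq_smul_one_of_forall_pauliString {n : ℕ} {W : QubitMatrix n}
    (h : ∀ s, Commute W (pauliString s)) : ∃ c : ℂ, W = c • 1 := by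
  have hall : ∀ M, Commute W M := by
    intro M
    have hM : M ∈ Submodule.span ℂ (Set.range (pauliString : (Fin n → Fin 4) → QubitMatrix n)) := by
      rw [span_pauliString]; trivial
    induction hM using Submodule.span_induction with
    | mem x hx => obtain ⟨s, rfl⟩ := hx; exact h s
    | zero => exact Commute.zero_right W
    | add x y _ _ hx hy => exact hx.add_right hy
    | smul a x _ hx => exact hx.smul_right a
  obtain ⟨c, hc⟩ := Matrix.mem_range_scalar_iff_commute_single'.mpr fun i j => (hall _).symm
  refine ⟨c, ?_⟩
  rw [← hc, Matrix.smul_one_eq_diagonal]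
  rfl

/-- The trace pairing is nondegenerate and the strings span. -/
theorem exists_trace_pauliString_mul_ne_zero {n : ℕ} {W : QubitMatrix n} (hW : W ≠ 0) :
    ∃ s, (pauliString s * W).trace ≠ 0 := by
  by_contra! h
  apply hW
  have hall : ∀ M : QubitMatrix n, (M * W).trace = 0 := by
    intro M
    have hM : M ∈ Submodule.span ℂ (Set.range (pauliString : (Fin n → Fin 4) → QubitMatrix n)) := by
      rw [span_pauliString]; trivial
    induction hM using Submodule.span_induction with
    | mem x hx => obtain ⟨s, rfl⟩ := hx; exact h s
    | zero => simp
    | add x y _ _ hx hy => rw [add_mul, Matrix.trace_add, hx, hy, add_zero]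
    | smul a x _ hx => rw [smul_mul_assoc, Matrix.trace_smul, hx, smul_zero]
  ext i j
  have := hall (Matrix.single j i 1)
  simpa [Matrix.trace_single_mul] using this

/-! ### Quarter turns. -/

/-- The quarter turn `(1 + i Q) / √2` about `Q`; it equals `exp (π i Q / 4)` when `Q ^ 2 = 1`. -/
noncomputable def quarterTurn {n : ℕ} (Q : QubitMatrix n) : QubitMatrix n :=
  ((Real.sqrt 2 : ℂ)⁻¹) • (1 + Complex.I • Q)

theorem inv_sqrt_two_mul_self : ((Real.sqrt 2 : ℂ)⁻¹) * ((Real.sqrt 2 : ℂ)⁻¹) = 1 / 2 := by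
  rw [← mul_inv, ← Complex.ofReal_mul, Real.mul_self_sqrt (by norm_num)]
  norm_num

/-- (1 ± Q)/2 are the spectral projections of the involution Q for the eigenvalues ±1. -/
theorem exp_smul_of_mul_self_eq_one {n : ℕ} {Q : QubitMatrix n} (hQ : Q * Q = 1) (c : ℂ) :
    NormedSpace.exp (c • Q) =
      (Complex.exp c / 2) • (1 + Q) + (Complex.exp (-c) / 2) • (1 - Q) := by
  have hp : ∀ k : ℕ, Q ^ k = (1 / 2 : ℂ) • (1 + Q) + ((-1) ^ k / 2 : ℂ) • (1 - Q) := by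
    intro k
    induction k with
    | zero => rw [pow_zero, pow_zero]; module
    | succ k ih =>
      rw [pow_succ, ih, add_mul, smul_mul_assoc, smul_mul_assoc, add_mul, sub_mul, hQ, one_mul, pow_succ]
      module
  have hs : ∀ z : ℂ, HasSum (fun k : ℕ => ((k.factorial : ℂ)⁻¹) * z ^ k) (Complex.exp z) := by
    intro z
    have := NormedSpace.exp_series_hasSum_exp' (𝕂 := ℂ) z
    rw [← Complex.exp_eq_exp_ℂ] at this
    simpa using this
  have h := (((hs c).div_const 2).smul_const (1 + Q)).add
    (((hs (-c)).div_const 2).smul_const (1 - Q))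
  rw [NormedSpace.exp_eq_tsum ℂ]
  refine Eq.trans ?_ h.tsum_eq
  refine tsum_congr fun k => ?_
  rw [smul_pow, hp, neg_pow c k]
  module

theorem exp_pi_div_four_smul {n : ℕ} {Q : QubitMatrix n} (hQ : Q * Q = 1) :
    NormedSpace.exp (((Real.pi : ℂ) * Complex.I / 4) • Q) = quarterTurn Q := by
  have hr : (Real.sqrt 2 : ℂ)⁻¹ = (Real.sqrt 2 : ℂ) / 2 := by
    have h0 : (Real.sqrt 2 : ℂ) ≠ 0 := by simp
    field_simp
    rw [sq, ← Complex.ofReal_mul, Real.mul_self_sqrt (by norm_num)]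
    norm_num
  have h1 : Complex.exp ((Real.pi : ℂ) * Complex.I / 4)
      = (Real.sqrt 2 : ℂ)⁻¹ * (1 + Complex.I) := by
    rw [show (Real.pi : ℂ) * Complex.I / 4 = ((Real.pi / 4 : ℝ) : ℂ) * Complex.I by
      push_cast; ring, Complex.exp_mul_I, ← Complex.ofReal_cos, ← Complex.ofReal_sin,
      Real.cos_pi_div_four, Real.sin_pi_div_four, hr]
    push_cast
    ring
  have h2 : Complex.exp (-((Real.pi : ℂ) * Complex.I / 4))
      = (Real.sqrt 2 : ℂ)⁻¹ * (1 - Complex.I) := by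
    rw [show -((Real.pi : ℂ) * Complex.I / 4) = ((-(Real.pi / 4) : ℝ) : ℂ) * Complex.I by
      push_cast; ring, Complex.exp_mul_I, ← Complex.ofReal_cos, ← Complex.ofReal_sin,
      Real.cos_neg, Real.sin_neg, Real.cos_pi_div_four, Real.sin_pi_div_four, hr]
    push_cast
    ring
  rw [exp_smul_of_mul_self_eq_one hQ, h1, h2, quarterTurn]
  module

section quarterTurn

variable {n : ℕ} {Q A : QubitMatrix n}

theorem quarterTurn_mul_quarterTurn_neg (hQ : Q * Q = 1) :
    quarterTurn Q * quarterTurn (-Q) = 1 := by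
  rw [quarterTurn, quarterTurn, smul_mul_smul_comm, inv_sqrt_two_mul_self]
  have : (1 + Complex.I • Q) * (1 + Complex.I • -Q) = (2 : ℂ) • 1 := by
    rw [add_mul, mul_add, mul_add, smul_mul_smul_comm, mul_neg, hQ, Complex.I_mul_I, mul_one,
      one_mul, mul_one]
    module
  rw [this, smul_smul]
  norm_num

theorem quarterTurn_neg_mul_quarterTurn (hQ : Q * Q = 1) :
    quarterTurn (-Q) * quarterTurn Q = 1 := by
  have := quarterTurn_mul_quarterTurn_neg (Q := -Q) (by rwa [neg_mul_neg])
  rwa [neg_neg] at this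

theorem quarterTurn_mul_self (hQ : Q * Q = 1) :
    quarterTurn Q * quarterTurn Q = Complex.I • Q := by
  rw [quarterTurn, smul_mul_smul_comm, inv_sqrt_two_mul_self]
  have : (1 + Complex.I • Q) * (1 + Complex.I • Q) = (2 * Complex.I) • Q := by
    rw [add_mul, mul_add, mul_add, smul_mul_smul_comm, hQ, Complex.I_mul_I, mul_one,
      one_mul, mul_one]
    module
  rw [this, smul_smul]
  ring_nf

theorem quarterTurn_mul_of_mul_eq_smul {B : QubitMatrix n} {e : ℂ} (h : Q * A = e • (A * B)) :
    quarterTurn Q * A = A * quarterTurn (e • B) := by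
  rw [quarterTurn, quarterTurn, smul_mul_assoc, mul_smul_comm, add_mul, mul_add, one_mul, mul_one,
    smul_mul_assoc, h, mul_smul_comm, mul_smul_comm]

theorem mul_quarterTurn_of_mul_eq_smul {B : QubitMatrix n} {e : ℂ} (h : A * Q = e • (B * A)) :
    A * quarterTurn Q = quarterTurn (e • B) * A := by
  rw [quarterTurn, quarterTurn, smul_mul_assoc, mul_smul_comm, add_mul, mul_add, one_mul, mul_one,
    mul_smul_comm, h, smul_mul_assoc, smul_mul_assoc]

/-- Moving A across turns T_Q into its inverse T_{-Q}, so conjugating A by T_Q amounts to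
multiplying by T_Q² = iQ. -/
theorem quarterTurn_mul_of_anticommute (hQ : Q * Q = 1) (h : Q * A = -(A * Q)) :
    quarterTurn Q * A = (Complex.I • (Q * A)) * quarterTurn Q := by
  have h1 : quarterTurn Q * A = A * quarterTurn (-Q) := by
    have := quarterTurn_mul_of_mul_eq_smul (Q := Q) (A := A) (B := Q) (e := -1)
      (by rw [h, neg_one_smul])
    rwa [neg_one_smul] at this
  have h2 : A * quarterTurn Q = quarterTurn (-Q) * A := by
    have := mul_quarterTurn_of_mul_eq_smul (Q := Q) (A := A) (B := Q) (e := -1)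
      (by rw [h, neg_one_smul, neg_neg])
    rwa [neg_one_smul] at this
  rw [← smul_mul_assoc, ← quarterTurn_mul_self hQ, mul_assoc, mul_assoc, h2,
    ← mul_assoc (quarterTurn Q) (quarterTurn (-Q)), quarterTurn_mul_quarterTurn_neg hQ, one_mul]

theorem IsPauli.quarterTurn_sign_mul (hQ : IsPauli Q) (h : Q * Q = 1) {a b : ℂ}
    (ha : a = 1 ∨ a = -1) (hb : b = 1 ∨ b = -1) :
    IsPauli (quarterTurn (a • Q) * quarterTurn (b • Q)) := by
  have h' : -Q * -Q = 1 := by rwa [neg_mul_neg]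
  rcases ha with rfl | rfl <;> rcases hb with rfl | rfl <;> simp only [one_smul, neg_one_smul]
  · rw [quarterTurn_mul_self h]; exact hQ.smul Complex.I_pow_four
  · rw [quarterTurn_mul_quarterTurn_neg h]; exact .one
  · rw [quarterTurn_neg_mul_quarterTurn h]; exact .one
  · rw [quarterTurn_mul_self h']; exact hQ.neg.smul Complex.I_pow_four

end quarterTurn

/-! ### Conjugation by products of quarter turns. -/

/-- `U` carries every Pauli `A` to a Pauli `B`, in the inverse-free form `U A = B U`. -/
def NormalizesPaulis {n : ℕ} (U : QubitMatrix n) : Prop :=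
  ∀ A, IsPauli A → ∃ B, IsPauli B ∧ U * A = B * U

/-- `U` and `A` commute up to a nonzero scalar. -/
def ProjCommute {n : ℕ} (U A : QubitMatrix n) : Prop :=
  ∃ c : ℂ, c ≠ 0 ∧ U * A = c • (A * U)

/-- `U = P * exp ((π i / 4) ∑ Q)` up to a scalar, where the `Q`s are commuting Hermitian Paulis
that commute with every Pauli commuting with `U` up to a scalar. -/
def HasRotationForm {n : ℕ} (U : QubitMatrix n) : Prop :=
  ∃ (α : ℂ) (P : QubitMatrix n) (l : List (QubitMatrix n)), IsPauli P ∧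
    (∀ Q ∈ l, IsPauli Q ∧ Q.IsHermitian ∧ ∀ A, IsPauli A → ProjCommute U A → Commute Q A) ∧
    (∀ Q ∈ l, ∀ R ∈ l, Commute Q R) ∧
    U = α • (P * NormedSpace.exp (((Real.pi : ℂ) * Complex.I / 4) • l.sum))

section

variable {n : ℕ} {U A B Q x : QubitMatrix n}

theorem exp_sum_cons {l : List (QubitMatrix n)} (hQ : Q * Q = 1) (h : ∀ R ∈ l, Commute Q R) :
    NormedSpace.exp (((Real.pi : ℂ) * Complex.I / 4) • (Q :: l).sum) =
      quarterTurn Q * NormedSpace.exp (((Real.pi : ℂ) * Complex.I / 4) • l.sum) ∧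
    NormedSpace.exp (((Real.pi : ℂ) * Complex.I / 4) • (Q :: l).sum) =
      NormedSpace.exp (((Real.pi : ℂ) * Complex.I / 4) • l.sum) * quarterTurn Q := by
  have hc : Commute (((Real.pi : ℂ) * Complex.I / 4) • Q)
      (((Real.pi : ℂ) * Complex.I / 4) • l.sum) :=
    ((Commute.list_sum_right Q l h).smul_left _).smul_right _
  rw [List.sum_cons, smul_add, ← exp_pi_div_four_smul hQ]
  refine ⟨Matrix.exp_add_of_commute _ _ hc, ?_⟩
  rw [add_comm]
  exact Matrix.exp_add_of_commute _ _ hc.symm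

theorem NormalizesPaulis.mul {V : QubitMatrix n} (hU : NormalizesPaulis U)
    (hV : NormalizesPaulis V) : NormalizesPaulis (U * V) := by
  intro A hA
  obtain ⟨B, hB, h⟩ := hV A hA
  obtain ⟨C, hC, h'⟩ := hU B hB
  exact ⟨C, hC, by rw [mul_assoc, h, ← mul_assoc, h', mul_assoc]⟩

theorem NormalizesPaulis.smul (hU : NormalizesPaulis U) (c : ℂ) : NormalizesPaulis (c • U) := by
  intro A hA
  obtain ⟨B, hB, h⟩ := hU A hA
  exact ⟨B, hB, by rw [smul_mul_assoc, h, mul_smul_comm]⟩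

theorem IsPauli.normalizesPaulis (hP : IsPauli U) : NormalizesPaulis U := by
  intro A hA
  obtain ⟨e, he, h⟩ := hP.commute_or hA
  refine ⟨e • A, hA.smul ?_, by rw [h, smul_mul_assoc]⟩
  rcases he with rfl | rfl <;> norm_num

theorem IsPauli.normalizesPaulis_quarterTurn (hQ : IsPauli Q) (h : Q * Q = 1) :
    NormalizesPaulis (quarterTurn Q) := by
  intro A hA
  obtain ⟨e, rfl | rfl, he⟩ := hQ.commute_or hA
  · refine ⟨A, hA, ?_⟩
    rw [quarterTurn_mul_of_mul_eq_smul he, one_smul]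
  · exact ⟨_, (hQ.mul hA).smul Complex.I_pow_four,
      quarterTurn_mul_of_anticommute h (by rw [he, neg_one_smul])⟩

theorem IsPauli.quarterTurn_mul_mul_quarterTurn (hQ : IsPauli Q) (h : Q * Q = 1)
    (hA : IsPauli A) : IsPauli (quarterTurn Q * A * quarterTurn Q) := by
  obtain ⟨e, he, hc⟩ := hQ.commute_or hA
  rw [quarterTurn_mul_of_mul_eq_smul hc, mul_assoc]
  have := hQ.quarterTurn_sign_mul h he (Or.inl rfl)
  rw [one_smul] at this
  exact hA.mul this

theorem exp_sum_properties (l : List (QubitMatrix n))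
    (hl : ∀ Q ∈ l, IsPauli Q ∧ Q * Q = 1) (hc : ∀ Q ∈ l, ∀ R ∈ l, Commute Q R) :
    NormalizesPaulis (NormedSpace.exp (((Real.pi : ℂ) * Complex.I / 4) • l.sum)) ∧
    ∀ P, IsPauli P → IsPauli (NormedSpace.exp (((Real.pi : ℂ) * Complex.I / 4) • l.sum) * P *
      NormedSpace.exp (((Real.pi : ℂ) * Complex.I / 4) • l.sum)) := by
  induction l with
  | nil =>
    simp only [List.sum_nil, smul_zero, NormedSpace.exp_zero, one_mul, mul_one]
    exact ⟨IsPauli.one.normalizesPaulis, fun _ h => h⟩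
  | cons Q l ih =>
    obtain ⟨h1, h2⟩ := ih (fun R hR => hl R (List.mem_cons_of_mem _ hR))
      fun R hR S hS => hc R (List.mem_cons_of_mem _ hR) S (List.mem_cons_of_mem _ hS)
    obtain ⟨hQ, hQQ⟩ := hl Q List.mem_cons_self
    obtain ⟨e1, e2⟩ := exp_sum_cons hQQ
      fun R hR => hc Q List.mem_cons_self R (List.mem_cons_of_mem _ hR)
    refine ⟨e1 ▸ (hQ.normalizesPaulis_quarterTurn hQQ).mul h1, fun P hP => ?_⟩
    -- The commuting factors are arranged with both turns about Q next to P; the sandwiched product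
    -- is a Pauli, to which induction applies.
    have h3 := h2 _ (hQ.quarterTurn_mul_mul_quarterTurn hQQ hP)
    nth_rw 1 [e2]
    rw [e1]
    simpa only [mul_assoc] using h3

theorem IsPauli.sq_mul_exp {P E : QubitMatrix n} (hP : IsPauli P)
    (hE : ∀ P, IsPauli P → IsPauli (E * P * E)) : IsPauli ((P * E) ^ 2) := by
  rw [sq, mul_assoc, ← mul_assoc E]
  exact hP.mul (hE P hP)

theorem ProjCommute.of_smul {c : ℂ} (hc : c ≠ 0) (h : ProjCommute U (c • A)) :
    ProjCommute U A := by
  obtain ⟨d, hd, h⟩ := h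
  refine ⟨d, hd, smul_right_injective _ hc ?_⟩
  simpa [smul_smul, mul_comm] using h

theorem ProjCommute.smul (h : ProjCommute U A) (c : ℂ) : ProjCommute U (c • A) := by
  obtain ⟨d, hd, h⟩ := h
  refine ⟨d, hd, ?_⟩
  rw [mul_smul_comm, h, smul_mul_assoc, smul_comm]

theorem isUnit_of_isPauli_sq (h : IsPauli (U ^ 2)) : IsUnit U :=
  (isUnit_pow_iff two_ne_zero).1 h.isUnit

/-! ### One reduction step. -/

/-- The data of one reduction step: `Q` is the Hermitian Pauli proportional to `B x`, where `B` is
the image of the Pauli `x` under `U`. -/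
structure ReductionData {n : ℕ} (U x B Q : QubitMatrix n) (d : ℂ) : Prop where
  normalizes : NormalizesPaulis U
  isPauli_sq : IsPauli (U ^ 2)
  isPauli_x : IsPauli x
  isPauli_B : IsPauli B
  isPauli_Q : IsPauli Q
  isHermitian : Q.IsHermitian
  ne_zero : d ≠ 0
  mul_eq : U * x = B * U
  eq_smul : B * x = d • Q

namespace ReductionData

variable {d : ℂ}

theorem mul_self (h : ReductionData U x B Q d) : Q * Q = 1 :=
  h.isPauli_Q.mul_self_of_isHermitian h.isHermitian

/-- Since U² is a Pauli, U sends B back to ±x; hence it sends Bx to ±xB, which is ±Bx. -/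
theorem projCommute (h : ReductionData U x B Q d) :
    ∃ e : ℂ, (e = 1 ∨ e = -1) ∧ U * Q = e • (Q * U) := by
  obtain ⟨C, hC, hBC⟩ := h.normalizes B h.isPauli_B
  obtain ⟨e, he, hx⟩ := h.isPauli_sq.commute_or h.isPauli_x
  have hCx : C = e • x := by
    have : C * U ^ 2 = (e • x) * U ^ 2 := by
      rw [smul_mul_assoc, ← hx, sq, mul_assoc U U x, h.mul_eq, ← mul_assoc, ← mul_assoc, hBC]
    exact h.isPauli_sq.isUnit.mul_right_cancel this
  obtain ⟨f, hf, hxB⟩ := h.isPauli_x.commute_or h.isPauli_B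
  refine ⟨e * f, ?_, smul_right_injective _ h.ne_zero ?_⟩
  · rcases he with rfl | rfl <;> rcases hf with rfl | rfl <;> simp
  · change d • (U * Q) = d • ((e * f) • (Q * U))
    rw [← mul_smul_comm, ← h.eq_smul, smul_comm, ← smul_mul_assoc, ← h.eq_smul, ← mul_assoc, hBC,
      mul_assoc, h.mul_eq, ← mul_assoc, hCx, smul_mul_assoc, hxB, smul_smul, smul_mul_assoc]

/-- Conjugation by U preserves commutation signs and fixes A up to a scalar, so A has the same sign
with x as with B; the two signs cancel in Bx. -/
theorem commute (h : ReductionData U x B Q d) (hA : IsPauli A) (hUA : ProjCommute U A) :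
    Commute Q A := by
  have hu := isUnit_of_isPauli_sq h.isPauli_sq
  obtain ⟨c, hc, hUA⟩ := hUA
  obtain ⟨e, he, hAx⟩ := hA.commute_or h.isPauli_x
  have hee : e * e = 1 := by rcases he with rfl | rfl <;> norm_num
  have hAB : A * B = e • (B * A) := by
    apply hu.mul_right_cancel
    apply smul_right_injective _ hc
    change c • (A * B * U) = c • (e • (B * A) * U)
    calc c • (A * B * U) = (c • (A * U)) * x := by
          rw [mul_assoc, ← h.mul_eq, smul_mul_assoc, mul_assoc]
      _ = U * (A * x) := by rw [← hUA, mul_assoc]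
      _ = e • (U * x * A) := by rw [hAx, mul_smul_comm, mul_assoc]
      _ = e • (B * (U * A)) := by rw [h.mul_eq, mul_assoc]
      _ = c • (e • (B * A) * U) := by
          rw [hUA, mul_smul_comm, smul_mul_assoc, smul_comm, mul_assoc]
  apply smul_right_injective _ h.ne_zero
  change d • (Q * A) = d • (A * Q)
  rw [← smul_mul_assoc, ← mul_smul_comm, ← h.eq_smul, ← mul_assoc, hAB, smul_mul_assoc, mul_assoc,
    mul_assoc, hAx, mul_smul_comm, smul_smul, hee, one_smul]

theorem commute_quarterTurn_neg (h : Commute Q A) : quarterTurn (-Q) * A = A * quarterTurn (-Q) := by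
  have := quarterTurn_mul_of_mul_eq_smul (Q := -Q) (A := A) (B := -Q) (e := 1)
    (by rw [one_smul]; exact h.neg_left)
  rwa [one_smul] at this

theorem projCommute_next (h : ReductionData U x B Q d) (hA : IsPauli A) (hUA : ProjCommute U A) :
    ProjCommute (U * quarterTurn (-Q)) A := by
  have hQA := h.commute hA hUA
  obtain ⟨c, hc, hUA⟩ := hUA
  refine ⟨c, hc, ?_⟩
  rw [mul_assoc, commute_quarterTurn_neg hQA, ← mul_assoc, hUA, smul_mul_assoc, mul_assoc]

theorem normalizes_next (h : ReductionData U x B Q d) :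
    NormalizesPaulis (U * quarterTurn (-Q)) :=
  h.normalizes.mul (h.isPauli_Q.neg.normalizesPaulis_quarterTurn
    (by rw [neg_mul_neg, h.mul_self]))

/-- Moving U across T_{-Q} only changes the sign of Q, so the two turns merge into a Pauli. -/
theorem isPauli_sq_next (h : ReductionData U x B Q d) :
    IsPauli ((U * quarterTurn (-Q)) ^ 2) := by
  have hnn : -Q * -Q = 1 := by rw [neg_mul_neg, h.mul_self]
  obtain ⟨e, he, hUQ⟩ := h.projCommute
  obtain ⟨f, hf, hsq⟩ := h.isPauli_sq.commute_or h.isPauli_Q.neg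
  have hUT : quarterTurn (-Q) * U = U * quarterTurn (e • -Q) := by
    apply quarterTurn_mul_of_mul_eq_smul
    have hee : e * e = 1 := by rcases he with rfl | rfl <;> norm_num
    rw [mul_neg, neg_mul, hUQ, smul_neg, smul_smul, hee, one_smul]
  have h2 := h.isPauli_Q.neg.quarterTurn_sign_mul hnn he (Or.inl rfl)
  rw [one_smul] at h2
  have h3 : (U * quarterTurn (-Q)) ^ 2 = U ^ 2 * (quarterTurn (e • -Q) * quarterTurn (-Q)) := by
    rw [sq, sq, mul_assoc, ← mul_assoc (quarterTurn (-Q)), hUT]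
    simp only [mul_assoc]
  rw [h3]
  exact h.isPauli_sq.mul h2

theorem hasRotationForm (h : ReductionData U x B Q d)
    (hU : HasRotationForm (U * quarterTurn (-Q))) : HasRotationForm U := by
  obtain ⟨α, P, l, hP, hl, hc, hU⟩ := hU
  have hQ' : ProjCommute U Q := by
    obtain ⟨e, he, hUQ⟩ := h.projCommute
    exact ⟨e, by rcases he with rfl | rfl <;> norm_num, hUQ⟩
  -- Q is itself a Pauli fixed up to a scalar by the next unitary, so the rotations found later
  -- commute with it.
  have hQl : ∀ R ∈ l, Commute Q R := fun R hR =>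
    ((hl R hR).2.2 Q h.isPauli_Q (h.projCommute_next h.isPauli_Q hQ')).symm
  refine ⟨α, P, Q :: l, hP, ?_, ?_, ?_⟩
  · intro R hR
    rcases List.mem_cons.1 hR with rfl | hR
    · exact ⟨h.isPauli_Q, h.isHermitian, fun A hA hUA => h.commute hA hUA⟩
    · exact ⟨(hl R hR).1, (hl R hR).2.1, fun A hA hUA =>
        (hl R hR).2.2 A hA (h.projCommute_next hA hUA)⟩
  · intro R hR S hS
    rcases List.mem_cons.1 hR with hR' | hR' <;> rcases List.mem_cons.1 hS with hS' | hS'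
    · rw [hR', hS']
    · exact hR' ▸ hQl S hS'
    · exact hS' ▸ (hQl R hR').symm
    · exact hc R hR' S hS'
  · rw [(exp_sum_cons h.mul_self hQl).2, ← mul_assoc, ← smul_mul_assoc, ← hU, mul_assoc,
      quarterTurn_neg_mul_quarterTurn h.mul_self, mul_one]

theorem mul_quarterTurn_neg_mul {y C : QubitMatrix n} (h : ReductionData U x B Q d)
    (hC : U * y = C * U) (hy : Q * y = -(y * Q)) :
    ∃ c : ℂ, c ^ 4 = 1 ∧ U * quarterTurn (-Q) * y = (c • (Q * C)) * (U * quarterTurn (-Q)) := by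
  obtain ⟨e, he, hUQ⟩ := h.projCommute
  refine ⟨-Complex.I * e, ?_, ?_⟩
  · rcases he with rfl | rfl <;> simp [Even.neg_pow (show Even 4 by decide)]
  · rw [mul_assoc, quarterTurn_mul_of_anticommute (by rw [neg_mul_neg, h.mul_self])
      (by rw [neg_mul, hy, mul_neg])]
    have hQy : U * (Q * y) = e • (Q * C * U) := by
      rw [← mul_assoc, hUQ, smul_mul_assoc, mul_assoc Q U, hC, ← mul_assoc Q]
    rw [← mul_assoc, mul_smul_comm, neg_mul, mul_neg, hQy, ← mul_assoc]
    simp only [smul_mul_assoc, neg_mul]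
    module

/-- The new image of x is proportional to QB, hence to BxB, hence to x. -/
theorem projCommute_x_next (h : ReductionData U x B Q d) (hx : x * B = -(B * x)) :
    ProjCommute (U * quarterTurn (-Q)) x := by
  have hQx : Q * x = -(x * Q) := by
    apply smul_right_injective _ h.ne_zero
    change d • (Q * x) = d • (-(x * Q))
    rw [smul_neg, ← smul_mul_assoc, ← mul_smul_comm, ← h.eq_smul, ← mul_assoc x, hx, neg_mul,
      neg_neg]
  obtain ⟨c, hc, hUx⟩ := h.mul_quarterTurn_neg_mul h.mul_eq hQx
  obtain ⟨f, hf, hBB⟩ := h.isPauli_B.exists_mul_self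
  have hQB : Q * B = (-(d⁻¹ * f)) • x := by
    have : Q = d⁻¹ • (B * x) := by rw [h.eq_smul, smul_smul, inv_mul_cancel₀ h.ne_zero, one_smul]
    rw [this, smul_mul_assoc, mul_assoc, hx, mul_neg, ← mul_assoc, hBB, smul_mul_assoc, one_mul,
      smul_neg, smul_smul, neg_smul]
  have hf0 : f ≠ 0 := by rintro rfl; norm_num at hf
  refine ⟨c * (-(d⁻¹ * f)), mul_ne_zero (IsPauli.ne_zero_of_pow_four hc)
    (neg_ne_zero.2 (mul_ne_zero (inv_ne_zero h.ne_zero) hf0)), ?_⟩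
  rw [hUx, hQB, smul_smul, smul_mul_assoc]

end ReductionData

/-! ### Descent on the number of moved Pauli strings. -/

theorem exists_reductionData (hU : NormalizesPaulis U) (h2 : IsPauli (U ^ 2)) (hx : IsPauli x)
    (hB : IsPauli B) (h : U * x = B * U) : ∃ Q d, ReductionData U x B Q d := by
  obtain ⟨Q, d, hd, hQ, hH, hBx⟩ := (hB.mul hx).exists_isHermitian
  exact ⟨Q, d, hU, h2, hx, hB, hQ, hH, hd, h, hBx⟩

/-- A Pauli commuting with all Paulis is a scalar. -/
theorem IsPauli.exists_anticommute (hA : IsPauli A) (h : ¬ ∃ c : ℂ, A = c • 1) :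
    ∃ y, IsPauli y ∧ A * y = -(y * A) := by
  by_contra! hall
  apply h
  refine eq_smul_one_of_forall_pauliString fun s => ?_
  obtain ⟨e, rfl | rfl, he⟩ := hA.commute_or (IsPauli.pauliString s)
  · rw [one_smul] at he; exact he
  · rw [neg_one_smul] at he
    exact absurd he (hall _ (.pauliString s))

/-- Choose s with tr(sU) ≠ 0. Conjugating sU by any string multiplies it by a scalar and preserves
this trace, so the scalar is 1 and sU is central. -/
theorem exists_isPauli_eq_smul (hU : IsUnit U) (h : ∀ s, ProjCommute U (pauliString s)) :
    ∃ (α : ℂ) (P : QubitMatrix n), IsPauli P ∧ U = α • P := by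
  obtain ⟨s, hs⟩ := exists_trace_pauliString_mul_ne_zero hU.ne_zero
  have hW : ∀ t, Commute (pauliString s * U) (pauliString t) := by
    intro t
    obtain ⟨c, hc, hUt⟩ := h t
    obtain ⟨e, he, hst⟩ := pauliString_commute_or s t
    have h1 : pauliString s * U * pauliString t
        = (c * e) • (pauliString t * (pauliString s * U)) := by
      rw [mul_assoc, hUt, mul_smul_comm, ← mul_assoc, hst, smul_mul_assoc, smul_smul, mul_assoc]
    have h2 := congrArg (fun M => (M * pauliString t).trace) h1
    simp only [mul_assoc (pauliString s * U) (pauliString t), pauliString_mul_self, mul_one,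
      smul_mul_assoc, Matrix.trace_smul] at h2
    rw [Matrix.trace_mul_comm (pauliString t * _), ← mul_assoc, pauliString_mul_self, one_mul,
      smul_eq_mul] at h2
    have h3 : c * e = 1 := by
      apply mul_right_cancel₀ hs
      rw [← h2, one_mul]
    rw [h3, one_smul] at h1
    exact h1
  obtain ⟨α, hα⟩ := eq_smul_one_of_forall_pauliString hW
  refine ⟨α, pauliString s, .pauliString s, ?_⟩
  rw [← one_mul U, ← pauliString_mul_self s, mul_assoc, hα, mul_smul_comm, mul_one]

open Classical in
/-- The number of Pauli strings not fixed by `U` up to a scalar. -/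
noncomputable def movedCount {n : ℕ} (U : QubitMatrix n) : ℕ :=
  (Finset.univ.filter fun s : Fin n → Fin 4 => ¬ ProjCommute U (pauliString s)).card

theorem movedCount_lt {V : QubitMatrix n}
    (hUV : ∀ A, IsPauli A → ProjCommute U A → ProjCommute V A)
    (hx : IsPauli x) (hU : ¬ ProjCommute U x) (hV : ProjCommute V x) :
    movedCount V < movedCount U := by
  obtain ⟨c, s, hc, rfl⟩ := hx
  apply Finset.card_lt_card
  refine (Finset.ssubset_iff_of_subset ?_).2 ⟨s, ?_, ?_⟩
  · intro t ht
    simp only [Finset.mem_filter, Finset.mem_univ, true_and] at ht ⊢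
    exact fun h => ht (hUV _ (.pauliString t) h)
  · simp only [Finset.mem_filter, Finset.mem_univ, true_and]
    exact fun h => hU (h.smul c)
  · simp only [Finset.mem_filter, Finset.mem_univ, true_and, not_not]
    exact hV.of_smul (IsPauli.ne_zero_of_pow_four hc)

theorem exists_reduction_of_anticommute (hU : NormalizesPaulis U) (h2 : IsPauli (U ^ 2))
    (hx : IsPauli x) (hB : IsPauli B) (h : U * x = B * U) (hxB : x * B = -(B * x)) :
    ∃ V : QubitMatrix n, NormalizesPaulis V ∧ IsPauli (V ^ 2) ∧
      (HasRotationForm V → HasRotationForm U) ∧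
      (∀ A, IsPauli A → ProjCommute U A → ProjCommute V A) ∧
      ¬ ProjCommute U x ∧ ProjCommute V x := by
  obtain ⟨Q, d, D⟩ := exists_reductionData hU h2 hx hB h
  refine ⟨_, D.normalizes_next, D.isPauli_sq_next, D.hasRotationForm,
    fun A => D.projCommute_next, ?_, D.projCommute_x_next hxB⟩
  -- If U fixed x up to a scalar, B would be proportional to x and commute with it, contradicting
  -- anticommutation.
  rintro ⟨c, hc, hUx⟩
  have hBx : B = c • x := by
    apply (isUnit_of_isPauli_sq h2).mul_right_cancel
    rw [← h, hUx, smul_mul_assoc]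
  have h0 : x * x = 0 := by
    rw [hBx, mul_smul_comm, smul_mul_assoc, ← smul_neg] at hxB
    have h3 : (2 : ℂ) • (x * x) = 0 := by
      rw [two_smul]
      exact add_eq_zero_iff_eq_neg.2 (smul_right_injective _ hc hxB)
    exact (smul_eq_zero.1 h3).resolve_left two_ne_zero
  exact (hx.mul hx).isUnit.ne_zero h0

theorem exists_reduction (hU : NormalizesPaulis U) (h2 : IsPauli (U ^ 2)) (hx : IsPauli x)
    (hUx : ¬ ProjCommute U x) :
    ∃ V : QubitMatrix n, NormalizesPaulis V ∧ IsPauli (V ^ 2) ∧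
      (HasRotationForm V → HasRotationForm U) ∧
      movedCount V < movedCount U := by
  by_cases hanti : ∃ x B, IsPauli x ∧ IsPauli B ∧ U * x = B * U ∧ x * B = -(B * x)
  · obtain ⟨x, B, hx, hB, h, hxB⟩ := hanti
    obtain ⟨V, hV, hV2, hVU, hmono, h1, h3⟩ := exists_reduction_of_anticommute hU h2 hx hB h hxB
    exact ⟨V, hV, hV2, hVU, movedCount_lt hmono hx h1 h3⟩
  · push Not at hanti
    have hcomm : ∀ x B, IsPauli x → IsPauli B → U * x = B * U → x * B = B * x := by
      intro x B hx hB h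
      obtain ⟨e, rfl | rfl, he⟩ := hx.commute_or hB
      · rwa [one_smul] at he
      · rw [neg_one_smul] at he
        exact absurd he (hanti x B hx hB h)
    obtain ⟨B, hB, h⟩ := hU x hx
    obtain ⟨Q, d, D⟩ := exists_reductionData hU h2 hx hB h
    have hQ : ¬ ∃ c : ℂ, Q = c • 1 := by
      rintro ⟨c, rfl⟩
      obtain ⟨f, hf, hxx⟩ := hx.exists_mul_self
      have hf0 : f ≠ 0 := by rintro rfl; norm_num at hf
      have hc0 : c ≠ 0 := by
        rintro rfl
        exact D.isPauli_Q.isUnit.ne_zero (zero_smul _ _)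
      apply hUx
      refine ⟨f⁻¹ * (d * c), mul_ne_zero (inv_ne_zero hf0) (mul_ne_zero D.ne_zero hc0), ?_⟩
      have hBx : B = (f⁻¹ * (d * c)) • x := by
        rw [mul_smul, eq_inv_smul_iff₀ hf0]
        calc f • B = B * (x * x) := by rw [hxx, mul_smul_comm, mul_one]
          _ = (d * c) • x := by
            rw [← mul_assoc, D.eq_smul, smul_smul, smul_mul_assoc, one_mul]
      rw [h, ← smul_mul_assoc, ← hBx]
    obtain ⟨y, hy, hQy⟩ := D.isPauli_Q.exists_anticommute hQ
    obtain ⟨C, hC, hUy⟩ := hU y hy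
    obtain ⟨c, hc, hUy'⟩ := D.mul_quarterTurn_neg_mul hUy hQy
    have hyC := hcomm y C hy hC hUy
    obtain ⟨V, hV, hV2, hVU, hmono, h1, h3⟩ := exists_reduction_of_anticommute
      D.normalizes_next D.isPauli_sq_next hy ((D.isPauli_Q.mul hC).smul hc) hUy' (by
        rw [mul_smul_comm, smul_mul_assoc, ← smul_neg, ← mul_assoc, mul_assoc Q C, ← hyC,
          ← mul_assoc Q y, hQy, neg_mul, neg_neg])
    exact ⟨V, hV, hV2, fun hr => D.hasRotationForm (hVU hr),
      movedCount_lt (fun A hA hUA => hmono A hA (D.projCommute_next hA hUA)) hy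
        (fun hUy => h1 (D.projCommute_next hy hUy)) h3⟩

theorem hasRotationForm_of_isPauli_sq (hU : NormalizesPaulis U) (h2 : IsPauli (U ^ 2)) :
    HasRotationForm U := by
  induction hk : movedCount U using Nat.strong_induction_on generalizing U with
  | _ k ih =>
    by_cases hall : ∀ s, ProjCommute U (pauliString s)
    · obtain ⟨α, P, hP, h⟩ := exists_isPauli_eq_smul (isUnit_of_isPauli_sq h2) hall
      refine ⟨α, P, [], hP, by simp, by simp, ?_⟩
      rw [List.sum_nil, smul_zero, NormedSpace.exp_zero, mul_one, h]
    · push Not at hall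
      obtain ⟨s, hs⟩ := hall
      obtain ⟨V, hV, hV2, hVU, hlt⟩ := exists_reduction hU h2 (.pauliString s) hs
      exact hVU (ih _ (hk ▸ hlt) hV hV2 rfl)

/-! ### The equivalence for unitaries. -/

theorem isClifford_iff_normalizesPaulis (U : Matrix.unitaryGroup (Fin n → Fin 2) ℂ) :
    IsClifford U ↔ NormalizesPaulis (U : QubitMatrix n) := by
  have h1 : (U : QubitMatrix n).conjTranspose * U = 1 := Matrix.UnitaryGroup.star_mul_self U
  have h2 : (U : QubitMatrix n) * (U : QubitMatrix n).conjTranspose = 1 := U.2.2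
  constructor
  · intro h A hA
    exact ⟨_, h A hA, by rw [mul_assoc, h1, mul_one]⟩
  · intro h A hA
    obtain ⟨B, hB, hUA⟩ := h A hA
    rwa [hUA, mul_assoc, h2, mul_one]

theorem isCliffordWithPauliSquare_iff (U : Matrix.unitaryGroup (Fin n → Fin 2) ℂ) :
    IsCliffordWithPauliSquare U ↔ HasPSCForm (U : QubitMatrix n) := by
  rw [IsCliffordWithPauliSquare, isClifford_iff_normalizesPaulis]
  constructor
  · rintro ⟨hU, h2⟩
    obtain ⟨α, P, l, hP, hl, hc, h⟩ := hasRotationForm_of_isPauli_sq hU h2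
    have hE := (exp_sum_properties l
      (fun Q hQ => ⟨(hl Q hQ).1, (hl Q hQ).1.mul_self_of_isHermitian (hl Q hQ).2.1⟩) hc).2
    refine ⟨α, P, l.length, l.get, ?_, hP,
      fun j => ⟨(hl _ (l.get_mem j)).1, (hl _ (l.get_mem j)).2.1⟩,
      fun j k => hc _ (l.get_mem j) _ (l.get_mem k), ?_⟩
    -- Both (PE)² and α²(PE)² are Paulis, where E is the exponential, so (α²)⁴ = 1.
    · rw [h, smul_pow] at h2
      have := (hP.sq_mul_exp hE).pow_four_eq_one_of_smul h2
      rwa [← pow_mul] at this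
    · rw [h, ← List.sum_ofFn, List.ofFn_get]
  · rintro ⟨α, P, m, Q, hα, hP, hQ, hc, h⟩
    obtain ⟨h1, hE⟩ := exp_sum_properties (List.ofFn Q)
      (by
        intro R hR
        obtain ⟨j, rfl⟩ := List.mem_ofFn.1 hR
        exact ⟨(hQ j).1, (hQ j).1.mul_self_of_isHermitian (hQ j).2⟩)
      (by
        intro R hR S hS
        obtain ⟨j, rfl⟩ := List.mem_ofFn.1 hR
        obtain ⟨k, rfl⟩ := List.mem_ofFn.1 hS
        exact hc j k)
    rw [List.sum_ofFn] at h1 hE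
    rw [h, smul_pow]
    exact ⟨(hP.normalizesPaulis.mul h1).smul α,
      (hP.sq_mul_exp hE).smul (by rw [← pow_mul, hα])⟩

end

theorem proposition1 (n : ℕ) (U : Matrix.unitaryGroup (Fin n → Fin 2) ℂ) :
    (IsCliffordWithPauliSquare U ↔ HasPSCForm (U : QubitMatrix n)) ∧
    (IsPSC U ↔ ¬ IsPauli (U : QubitMatrix n) ∧ HasPSCForm (U : QubitMatrix n)) :=
  ⟨isCliffordWithPauliSquare_iff U, by
    rw [IsPSC, isCliffordWithPauliSquare_iff, and_comm]⟩
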